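/- Let $X\neq\{0\}$ be a real Banach space with closed unit ball $B_X$, unit sphere $S_X$ and dual $X^*$. For $x^*\in S_{X^*}$ and $\varepsilon>0$ put $S(x^*,\varepsilon)=\{x\in B_X : x^*(x)>1-\varepsilon\}$, and for $x\in S_X$ and $\varepsilon>0$ put $S(x,\varepsilon)=\{x^*\in B_{X^*} : x^*(x)>1-\varepsilon\}$. The space $X$ has the local diameter 2 property+ (LD2P+) if for every $x^*\in S_{X^*}$, every $\varepsilon>0$, every $\delta>0$ and every $x\in S(x^*,\varepsilon)\cap S_X$ there exists $y\in S(x^*,\varepsilon)$ with $\|x-y\|>2-\delta$. A point $x^*\in B_{X^*}$ is a weak$^*$-denting point of $B_{X^*}$ if for every $\eta>0$ there are $x\in S_X$ and $\delta>0$ such that $x^*\in S(x,\delta)$ and $S(x,\delta)$ has norm diameter less than $\eta$. A Banach space $E$ has the Radon–Nikodým property if for every finite measure space $(\Omega,\Sigma,\mu)$ and every countably additive $G:\Sigma\to E$ of bounded variation that vanishes on all $\mu$-null sets there is a Bochner integrable $g:\Omega\to E$ with $G(A)=\int_A g\,d\mu$ for all $A\in\Sigma$. If $B_{X^*}$ contains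 a weak$^*$-denting point, then $X$ does not have the LD2P+. In particular, if $X^*$ has the Radon–Nikodým property, then $X$ does not have the LD2P+. -/

import Mathlib

open MeasureTheory

namespace LocalDiameterTwo

/-- The slice `S(f, ε) = {x ∈ B_X : f x > 1 - ε}` of the closed unit ball of `X`
(used with `‖f‖ = 1` and `ε > 0`). -/
def slice {X : Type*} [NormedAddCommGroup X] [NormedSpace ℝ X]
    (f : StrongDual ℝ X) (ε : ℝ) : Set X :=
  {x | ‖x‖ ≤ 1 ∧ 1 - ε < f x}

/-- The weak* slice `S(x, ε) = {f ∈ B_{X*} : f x > 1 - ε}` of the closed dual unit ball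
(used with `‖x‖ = 1` and `ε > 0`). -/
def weakStarSlice {X : Type*} [NormedAddCommGroup X] [NormedSpace ℝ X]
    (x : X) (ε : ℝ) : Set (StrongDual ℝ X) :=
  {f | ‖f‖ ≤ 1 ∧ 1 - ε < f x}

/-- The local diameter 2 property+ (LD2P+): in every slice `S` of the unit ball, every norm-one
point of `S` is at distance as close to `2` as we want from some other point of `S`. -/
def LD2PPlus (X : Type*) [NormedAddCommGroup X] [NormedSpace ℝ X] : Prop :=
  ∀ f : StrongDual ℝ X, ‖f‖ = 1 → ∀ ε : ℝ, 0 < ε → ∀ δ : ℝ, 0 < δ →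
    ∀ x ∈ slice f ε, ‖x‖ = 1 → ∃ y ∈ slice f ε, 2 - δ < ‖x - y‖

/-- `f` is a weak*-denting point of the dual unit ball: it belongs to weak* slices of the ball of
arbitrarily small norm diameter. (Slices are bounded, so `Metric.diam` is their true diameter.) -/
def IsWeakStarDentingPoint {X : Type*} [NormedAddCommGroup X] [NormedSpace ℝ X]
    (f : StrongDual ℝ X) : Prop :=
  ‖f‖ ≤ 1 ∧ ∀ η : ℝ, 0 < η → ∃ x : X, ‖x‖ = 1 ∧ ∃ δ : ℝ, 0 < δ ∧
    f ∈ weakStarSlice x δ ∧ Metric.diam (weakStarSlice x δ) < η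

/-- The Radon–Nikodým property: for every finite measure space `(Ω, μ)`, every countably additive
`E`-valued measure on `Ω` that is of bounded variation and vanishes on the `μ`-null sets has a
Bochner integrable density with respect to `μ`.

Only the base universe is used for `Ω`; this loses nothing, since the property is already
decided by Lebesgue measure on `[0, 1]`. -/
def RadonNikodymProperty (E : Type*) [NormedAddCommGroup E] [NormedSpace ℝ E] : Prop :=
  ∀ (Ω : Type) [MeasurableSpace Ω] (μ : Measure Ω) [IsFiniteMeasure μ] (G : VectorMeasure Ω E),
    G.variation Set.univ < ⊤ →
    (∀ s : Set Ω, MeasurableSet s → μ s = 0 → G s = 0) →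
    ∃ g : Ω → E, Integrable g μ ∧ ∀ s : Set Ω, MeasurableSet s → G s = ∫ ω in s, g ω ∂μ

end LocalDiameterTwo

open Filter Topology

/-! ### Dyadic martingales as trees indexed by binary words -/

namespace LocalDiameterTwo

/-! Under the LD2P+, every weak* slice of the dual ball contains two functionals at distance at
least 1 (`LD2PPlus.exists_far_in_weakStarSlice`), so there are no weak*-denting points.

For the Radon–Nikodým part, such a pair gives a one-step martingale that oscillates and whose root
lies in the slice. The roots of oscillating martingales are closed under midpoints and meet every
weak* slice, so by Hahn–Banach they are weak* dense in the dual ball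
(`exists_near_of_forall_weakStarSlice`). Baire's theorem on the weak* compact set of martingales
then yields one that is not Cauchy in mean (`exists_martingale_forall_wordMean_gt`). The
Radon–Nikodým property forbids this: a martingale in the ball defines a measure dominated by coin
tossing, and the martingale converges in `L¹` to its density
(`RadonNikodymProperty.exists_forall_wordMean_le`). -/

/-- The mean of `φ` over all binary words of length `N`. -/
noncomputable def wordMean : ℕ → (List Bool → ℝ) → ℝ
  | 0, φ => φ []
  | N + 1, φ => (wordMean N (fun s => φ (false :: s)) + wordMean N (fun s => φ (true :: s))) / 2

lemma wordMean_const (N : ℕ) (r : ℝ) : wordMean N (fun _ => r) = r := by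
  induction N with
  | zero => rfl
  | succ N ih => simp [wordMean, ih]

section Trees

variable {E : Type*} [NormedAddCommGroup E] [NormedSpace ℝ E]

/-- A dyadic martingale in the unit ball, indexed by binary words. -/
structure IsDyadicMartingale (t : List Bool → E) : Prop where
  norm_le : ∀ s, ‖t s‖ ≤ 1
  two_smul : ∀ s, (2 : ℝ) • t s = t (s ++ [false]) + t (s ++ [true])

/-- From some level on, `t` stays at mean distance at least `1 / 2` from every function of the
first `n` letters. -/
def Oscillates (n : ℕ) (t : List Bool → E) : Prop :=
  ∃ N₀, ∀ N ≥ N₀, ∀ c : List Bool → E, 1 / 2 ≤ wordMean N (fun s => ‖t s - c (s.take n)‖)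

/-- The tree with prescribed subtrees at the two children of the root, whose value at the root is
the midpoint of the values at the children. -/
noncomputable def join (t₀ t₁ : List Bool → E) : List Bool → E
  | [] => (1 / 2 : ℝ) • (t₀ [] + t₁ [])
  | false :: s => t₀ s
  | true :: s => t₁ s

lemma IsDyadicMartingale.join {t₀ t₁ : List Bool → E} (h₀ : IsDyadicMartingale t₀)
    (h₁ : IsDyadicMartingale t₁) : IsDyadicMartingale (join t₀ t₁) where
  norm_le s := by
    match s with
    | [] =>
      have := norm_add_le (t₀ []) (t₁ [])
      have := h₀.norm_le []
      have := h₁.norm_le []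
      simp only [LocalDiameterTwo.join, norm_smul]
      norm_num
      linarith
    | false :: s => exact h₀.norm_le s
    | true :: s => exact h₁.norm_le s
  two_smul s := by
    match s with
    | [] => simp [LocalDiameterTwo.join, smul_smul]
    | false :: s => exact h₀.two_smul s
    | true :: s => exact h₁.two_smul s

lemma isDyadicMartingale_const {a : E} (ha : ‖a‖ ≤ 1) : IsDyadicMartingale (fun _ => a) where
  norm_le _ := ha
  two_smul _ := _root_.two_smul ℝ a

lemma IsDyadicMartingale.subtree {t : List Bool → E} (h : IsDyadicMartingale t) (b : Bool) :
    IsDyadicMartingale (fun s => t (b :: s)) where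
  norm_le _ := h.norm_le _
  two_smul s := h.two_smul (b :: s)

lemma Oscillates.join {n : ℕ} {t₀ t₁ : List Bool → E} (h₀ : Oscillates n t₀)
    (h₁ : Oscillates n t₁) : Oscillates (n + 1) (join t₀ t₁) := by
  obtain ⟨N₀, h₀⟩ := h₀
  obtain ⟨N₁, h₁⟩ := h₁
  refine ⟨max N₀ N₁ + 1, fun N hN c => ?_⟩
  obtain ⟨N, rfl⟩ : ∃ k, N = k + 1 := ⟨N - 1, by omega⟩
  have e₀ := h₀ N (by omega) (fun s => c (false :: s))
  have e₁ := h₁ N (by omega) (fun s => c (true :: s))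
  simp only [wordMean, LocalDiameterTwo.join, List.take_succ_cons]
  linarith

omit [NormedSpace ℝ E] in
lemma Oscillates.of_succ {n : ℕ} {t : List Bool → E} (h : Oscillates (n + 1) t) :
    Oscillates n t := by
  obtain ⟨N₀, h⟩ := h
  refine ⟨N₀, fun N hN c => ?_⟩
  have := h N hN (fun s => c (s.take n))
  simpa [List.take_take] using this

omit [NormedSpace ℝ E] in
lemma Oscillates.mono {n m : ℕ} (hnm : n ≤ m) {t : List Bool → E} (h : Oscillates m t) :
    Oscillates n t := by
  induction m, hnm using Nat.le_induction with
  | base => exact h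
  | succ m _ ih => exact ih h.of_succ

/-- The distances from one vector to `a` and to `b` average at least `‖a - b‖ / 2`; hence the
constant `1 / 2` in `Oscillates`. -/
lemma oscillates_join_const {a b : E} (hab : 1 ≤ ‖a - b‖) :
    Oscillates 0 (join (fun _ => a) (fun _ => b)) := by
  refine ⟨1, fun N hN c => ?_⟩
  obtain ⟨N, rfl⟩ : ∃ k, N = k + 1 := ⟨N - 1, by omega⟩
  simp only [wordMean, join, List.take_zero, wordMean_const]
  have := norm_sub_le_norm_sub_add_norm_sub a (c []) b
  rw [norm_sub_rev (c []) b] at this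
  linarith

end Trees

variable {X : Type*} [NormedAddCommGroup X] [NormedSpace ℝ X]

/-- The hypothesis is applied at each node of level `l` and the subtrees are rejoined. Values at
shorter words are averages, so the error does not grow. -/
lemma exists_oscillating_near
    (h : ∀ f : StrongDual ℝ X, ‖f‖ ≤ 1 → ∀ (F : Finset X) (η : ℝ), 0 < η →
      ∃ t : List Bool → StrongDual ℝ X, IsDyadicMartingale t ∧ Oscillates 0 t ∧
        ∀ x ∈ F, |t [] x - f x| ≤ η)
    (l : ℕ) (m : List Bool → StrongDual ℝ X) (hm : IsDyadicMartingale m) (F : Finset X)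
    {η : ℝ} (hη : 0 < η) :
    ∃ t : List Bool → StrongDual ℝ X, IsDyadicMartingale t ∧ Oscillates l t ∧
      ∀ s : List Bool, s.length ≤ l → ∀ x ∈ F, |t s x - m s x| ≤ η := by
  induction l generalizing m with
  | zero =>
    obtain ⟨t, ht, ho, hx⟩ := h (m []) (hm.norm_le _) F η hη
    refine ⟨t, ht, ho, fun s hs => ?_⟩
    obtain rfl : s = [] := List.length_eq_zero_iff.mp (by omega)
    exact hx
  | succ l ih =>
    obtain ⟨t₀, h₀, o₀, x₀⟩ := ih _ (hm.subtree false)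
    obtain ⟨t₁, h₁, o₁, x₁⟩ := ih _ (hm.subtree true)
    refine ⟨join t₀ t₁, h₀.join h₁, o₀.join o₁, fun s hs x hx => ?_⟩
    match s with
    | [] =>
      have e₀ := abs_le.mp (x₀ [] (by simp) x hx)
      have e₁ := abs_le.mp (x₁ [] (by simp) x hx)
      have e := congrArg (fun f : StrongDual ℝ X => f x) (hm.two_smul [])
      simp only [join, add_apply, smul_apply, smul_eq_mul,
        List.nil_append] at e ⊢
      rw [abs_le]
      constructor <;> linarith
    | false :: s => exact x₀ s (by simpa using hs) x hx
    | true :: s => exact x₁ s (by simpa using hs) x hx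

/-! ### Baire category in the weak* compact space of martingales -/

variable (X) in
/-- The dyadic martingales in the dual unit ball, as a subset of a product of weak* topologies. -/
def martingaleSet : Set (List Bool → WeakDual ℝ X) :=
  {t | IsDyadicMartingale (fun s => WeakDual.toStrongDual (t s))}

variable (X) in
lemma isCompact_martingaleSet : IsCompact (martingaleSet X) := by
  have hc := isCompact_univ_pi
    (fun _ : List Bool => WeakDual.isCompact_closedBall (𝕜 := ℝ) (0 : StrongDual ℝ X) 1)
  have hcl : IsClosed (⋂ s : List Bool, {t : List Bool → WeakDual ℝ X |
      (2 : ℝ) • t s = t (s ++ [false]) + t (s ++ [true])}) :=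
    isClosed_iInter fun s => isClosed_eq (by fun_prop) (by fun_prop)
  convert! hc.inter_right hcl using 1
  ext t
  simp only [martingaleSet, Set.mem_ofPred_eq, Set.mem_inter_iff, Set.mem_pi, Set.mem_univ,
    true_imp_iff, Set.mem_iInter, Set.mem_preimage, mem_closedBall_zero_iff]
  exact ⟨fun h => ⟨h.norm_le, fun s => h.two_smul s⟩, fun h => ⟨h.1, fun s => h.2 s⟩⟩

lemma lowerSemicontinuous_norm_toStrongDual :
    LowerSemicontinuous fun f : WeakDual ℝ X => ‖WeakDual.toStrongDual f‖ := by
  rw [lowerSemicontinuous_iff_isClosed_preimage]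
  intro r
  convert! WeakDual.isClosed_closedBall (𝕜 := ℝ) (0 : StrongDual ℝ X) r using 1
  ext f
  simp

lemma lowerSemicontinuous_wordMean {α : Type*} [TopologicalSpace α] (N : ℕ)
    {φ : α → List Bool → ℝ} (hφ : ∀ s, LowerSemicontinuous fun a => φ a s) :
    LowerSemicontinuous fun a => wordMean N (φ a) := by
  induction N generalizing φ with
  | zero => exact hφ []
  | succ N ih =>
    refine (continuous_id.div_const (2 : ℝ)).comp_lowerSemicontinuous
      ((ih fun s => hφ (false :: s)).add (ih fun s => hφ (true :: s))) ?_
    intro x y hxy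
    simpa using div_le_div_of_nonneg_right hxy zero_le_two

theorem exists_martingale_forall_wordMean_gt
    (h : ∀ f : StrongDual ℝ X, ‖f‖ ≤ 1 → ∀ (F : Finset X) (η : ℝ), 0 < η →
      ∃ t : List Bool → StrongDual ℝ X, IsDyadicMartingale t ∧ Oscillates 0 t ∧
        ∀ x ∈ F, |t [] x - f x| ≤ η) :
    ∃ t : List Bool → StrongDual ℝ X, IsDyadicMartingale t ∧
      ∀ n, ∃ N ≥ n, 1 / 4 < wordMean N (fun s => ‖t s - t (s.take n)‖) := by
  classical
  have : CompactSpace (martingaleSet X) :=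
    isCompact_iff_compactSpace.mp (isCompact_martingaleSet X)
  let O (n : ℕ) : Set (martingaleSet X) := ⋃ N ≥ n, {t | 1 / 4 <
    wordMean N (fun s => ‖WeakDual.toStrongDual (t.1 s - t.1 (s.take n))‖)}
  have hO (n : ℕ) : IsOpen (O n) := by
    refine isOpen_biUnion fun N _ => ?_
    refine (lowerSemicontinuous_wordMean N fun s => ?_).isOpen_preimage (1 / 4)
    exact lowerSemicontinuous_norm_toStrongDual.comp
      (((continuous_apply s).comp continuous_subtype_val).sub
        ((continuous_apply (s.take n)).comp continuous_subtype_val))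
  have hd (n : ℕ) : Dense (O n) := by
    rintro ⟨m, hm⟩
    -- The index holds the test vectors and a number serving as both depth and precision; together
    -- these exhaust the weak* product neighbourhoods of `m`.
    have key (i : Finset X × ℕ) := exists_oscillating_near h (max n i.2)
      (fun s => WeakDual.toStrongDual (m s)) hm i.1 (η := 1 / ((i.2 : ℝ) + 1)) (by positivity)
    choose t ht ho hx using key
    let u (i : Finset X × ℕ) : martingaleSet X := ⟨fun s => StrongDual.toWeakDual (t i s), ht i⟩
    refine mem_closure_of_tendsto (f := u) (b := atTop) ?_ (Eventually.of_forall fun i => ?_)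
    · rw [tendsto_subtype_rng, tendsto_pi_nhds]
      intro s
      rw [tendsto_iff_forall_eval_tendsto_topDualPairing]
      intro x
      rw [tendsto_iff_norm_sub_tendsto_zero]
      have hz : Tendsto (fun i : Finset X × ℕ => 1 / ((i.2 : ℝ) + 1)) atTop (𝓝 0) := by
        rw [← prod_atTop_atTop_eq]
        exact tendsto_one_div_add_atTop_nhds_zero_nat.comp tendsto_snd
      refine squeeze_zero' (Eventually.of_forall fun _ => norm_nonneg _) ?_ hz
      filter_upwards [eventually_ge_atTop ({x}, s.length)] with i hi
      exact hx i s (hi.2.trans (le_max_right _ _)) x (hi.1 (by simp))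
    · obtain ⟨N₀, hN⟩ := (ho i).mono (le_max_left n i.2)
      refine Set.mem_biUnion (x := max n N₀) (le_max_left n N₀) ?_
      exact lt_of_lt_of_le (by norm_num) (hN _ (le_max_right n N₀) (t i))
  obtain ⟨⟨t, ht⟩, htO⟩ := by
    have : Nonempty (martingaleSet X) :=
      ⟨⟨0, isDyadicMartingale_const (a := (0 : StrongDual ℝ X)) (by simp)⟩⟩
    -- A compact Hausdorff space is a Baire space.
    exact (dense_iInter_of_isOpen hO hd).nonempty
  refine ⟨fun s => WeakDual.toStrongDual (t s), ht, fun n => ?_⟩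
  obtain ⟨N, hN, hgt⟩ := Set.mem_iUnion₂.mp (Set.mem_iInter.mp htO n)
  exact ⟨N, hN, hgt⟩

end LocalDiameterTwo

/-! ### Coin tossing: martingales with a density converge in mean -/

namespace LocalDiameterTwo

/-- The measure of infinitely many independent fair coin tosses. -/
noncomputable def coinMeasure : Measure (ℕ → Bool) :=
  Measure.infinitePi fun _ => (PMF.uniformOfFintype Bool).toMeasure

instance : IsProbabilityMeasure coinMeasure := by
  unfold coinMeasure
  infer_instance

/-- The word formed by the first `n` letters of `ω`. -/
def initialWord (n : ℕ) (ω : ℕ → Bool) : List Bool := List.ofFn fun i : Fin n => ω i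

@[simp] lemma length_initialWord (n : ℕ) (ω : ℕ → Bool) : (initialWord n ω).length = n := by
  simp [initialWord]

lemma initialWord_succ (n : ℕ) (ω : ℕ → Bool) :
    initialWord (n + 1) ω = initialWord n ω ++ [ω n] := by
  simp only [initialWord, List.ofFn_succ_last, Fin.val_castSucc, Fin.val_last]

lemma take_initialWord {n N : ℕ} (h : n ≤ N) (ω : ℕ → Bool) :
    (initialWord N ω).take n = initialWord n ω := by
  apply List.ext_getElem <;> simp [initialWord, h]

lemma continuous_comp_initialWord {E : Type*} [TopologicalSpace E] (φ : List Bool → E) (n : ℕ) :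
    Continuous fun ω => φ (initialWord n ω) :=
  (continuous_of_discreteTopology (f := fun v : Fin n → Bool => φ (List.ofFn v))).comp
    (by fun_prop : Continuous fun (ω : ℕ → Bool) (i : Fin n) => ω i)

/-- The set of infinite words beginning with `s`. -/
def cell (s : List Bool) : Set (ℕ → Bool) := {ω | initialWord s.length ω = s}

lemma cell_nil : cell [] = Set.univ := by
  ext ω
  simp [cell, initialWord]

lemma mem_cell_append {s : List Bool} {b : Bool} {ω : ℕ → Bool} :
    ω ∈ cell (s ++ [b]) ↔ ω ∈ cell s ∧ ω s.length = b := by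
  change initialWord (s ++ [b]).length ω = _ ↔ initialWord s.length ω = s ∧ _
  rw [List.length_append, List.length_singleton, initialWord_succ]
  simp only [← List.concat_eq_append, List.concat_inj]

lemma cell_eq_pi (s : List Bool) :
    cell s = Set.pi (Finset.range s.length) fun i => {s.getD i false} := by
  ext ω
  simp only [cell, Set.mem_ofPred_eq, Set.mem_pi, Finset.coe_range, Set.mem_Iio,
    Set.mem_singleton_iff]
  constructor
  · intro h i hi
    rw [← h]
    simp [initialWord, hi]
  · intro h
    refine List.ext_getElem (by simp) fun i _ hi => ?_
    have := h i hi
    simp_all [initialWord]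

lemma measurableSet_cell (s : List Bool) : MeasurableSet (cell s) := by
  rw [cell_eq_pi]
  exact MeasurableSet.pi (Finset.range s.length).countable_toSet fun _ _ => .of_discrete

lemma coinMeasure_real_cell (s : List Bool) : coinMeasure.real (cell s) = (1 / 2) ^ s.length := by
  rw [Measure.real, cell_eq_pi, coinMeasure, Measure.infinitePi_pi _ fun _ _ => .of_discrete]
  simp [PMF.uniformOfFintype_apply]

section Integrals

variable {E : Type*} [NormedAddCommGroup E] [NormedSpace ℝ E]

omit [NormedSpace ℝ E] in
lemma integrable_comp_initialWord (φ : List Bool → E) (n : ℕ) :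
    Integrable (fun ω => φ (initialWord n ω)) coinMeasure :=
  (continuous_comp_initialWord φ n).integrable_of_hasCompactSupport (HasCompactSupport.of_compactSpace _)

lemma setIntegral_cell_split {u : (ℕ → Bool) → E} (hu : Integrable u coinMeasure) (s : List Bool) :
    ∫ ω in cell s, u ω ∂coinMeasure =
      ∫ ω in cell (s ++ [false]), u ω ∂coinMeasure + ∫ ω in cell (s ++ [true]), u ω ∂coinMeasure := by
  rw [← setIntegral_union _ (measurableSet_cell _) hu.integrableOn hu.integrableOn]
  · congr 2
    ext ω
    simp only [Set.mem_union, mem_cell_append]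
    cases ω s.length <;> simp
  · rw [Set.disjoint_left]
    intro ω h h'
    have := (mem_cell_append.mp h).2.symm.trans (mem_cell_append.mp h').2
    simp at this

lemma setIntegral_cell_self [CompleteSpace E] (φ : List Bool → E) (s : List Bool) :
    ∫ ω in cell s, φ (initialWord s.length ω) ∂coinMeasure = (1 / 2 : ℝ) ^ s.length • φ s := by
  rw [setIntegral_congr_fun (g := fun _ => φ s) (measurableSet_cell s)
    fun ω (hω : initialWord s.length ω = s) => by simp only [hω], setIntegral_const,
    coinMeasure_real_cell]

lemma IsDyadicMartingale.setIntegral_cell [CompleteSpace E] {t : List Bool → E}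
    (ht : IsDyadicMartingale t) (k : ℕ) (s : List Bool) :
    ∫ ω in cell s, t (initialWord (s.length + k) ω) ∂coinMeasure =
      (1 / 2 : ℝ) ^ s.length • t s := by
  induction k generalizing s with
  | zero => exact setIntegral_cell_self t s
  | succ k ih =>
    have e (b : Bool) := ih (s ++ [b])
    simp only [List.length_append, List.length_singleton, add_right_comm _ 1 k] at e
    rw [← add_assoc, setIntegral_cell_split (integrable_comp_initialWord t _), e, e, ← smul_add,
      ← ht.two_smul, smul_smul]
    congr 1
    ring

lemma setIntegral_cell_eq_wordMean (φ : List Bool → ℝ) (k : ℕ) (s : List Bool) :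
    ∫ ω in cell s, φ (initialWord (s.length + k) ω) ∂coinMeasure =
      (1 / 2) ^ s.length * wordMean k (fun r => φ (s ++ r)) := by
  induction k generalizing s with
  | zero => simpa [wordMean] using setIntegral_cell_self φ s
  | succ k ih =>
    have e (b : Bool) := ih (s ++ [b])
    simp only [List.length_append, List.length_singleton, add_right_comm _ 1 k] at e
    rw [← add_assoc, setIntegral_cell_split (integrable_comp_initialWord φ _), e, e]
    simp only [wordMean, List.append_assoc, List.singleton_append]
    ring

lemma integral_eq_wordMean (φ : List Bool → ℝ) (n : ℕ) :
    ∫ ω, φ (initialWord n ω) ∂coinMeasure = wordMean n φ := by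
  simpa [cell_nil] using setIntegral_cell_eq_wordMean φ n []

/-- Averaging over the cells of level `n` contracts the `L¹` norm. -/
lemma setIntegral_norm_le [CompleteSpace E] {u : (ℕ → Bool) → E} (hu : Integrable u coinMeasure)
    {n : ℕ} {a : List Bool → E}
    (ha : ∀ s, s.length = n → ∫ ω in cell s, u ω ∂coinMeasure = (1 / 2 : ℝ) ^ n • a s)
    (k : ℕ) (s : List Bool) (hk : s.length + k = n) :
    ∫ ω in cell s, ‖a (initialWord n ω)‖ ∂coinMeasure ≤ ∫ ω in cell s, ‖u ω‖ ∂coinMeasure := by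
  induction k generalizing s with
  | zero =>
    obtain rfl : s.length = n := hk
    rw [setIntegral_cell_self (fun s => ‖a s‖)]
    refine le_trans (le_of_eq ?_) (norm_integral_le_integral_norm _)
    rw [ha s rfl, norm_smul]
    simp
  | succ k ih =>
    rw [setIntegral_cell_split (integrable_comp_initialWord (fun s => ‖a s‖) n),
      setIntegral_cell_split hu.norm]
    exact add_le_add (ih _ (by simp; omega)) (ih _ (by simp; omega))

lemma integral_norm_le [CompleteSpace E] {u : (ℕ → Bool) → E} (hu : Integrable u coinMeasure)
    {n : ℕ} {a : List Bool → E}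
    (ha : ∀ s, s.length = n → ∫ ω in cell s, u ω ∂coinMeasure = (1 / 2 : ℝ) ^ n • a s) :
    ∫ ω, ‖a (initialWord n ω)‖ ∂coinMeasure ≤ ∫ ω, ‖u ω‖ ∂coinMeasure := by
  simpa [cell_nil] using setIntegral_norm_le hu ha n [] (by simp)

/-- Every integrable function is an `L¹`-limit of functions of the first `n` letters. -/
lemma exists_approx_by_initialWord {g : (ℕ → Bool) → E} (hg : Integrable g coinMeasure) {ε : ℝ}
    (hε : 0 < ε) : ∃ n₀, ∀ n ≥ n₀, ∃ φ : List Bool → E,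
      ∫ ω, ‖g ω - φ (initialWord n ω)‖ ∂coinMeasure ≤ ε := by
  obtain ⟨h, -, hgh, hc, hi⟩ := hg.exists_hasCompactSupport_integral_sub_le (half_pos hε)
  -- The padded word agrees with `ω` on its first `n` letters, so it tends to `ω`.
  let pad (s : List Bool) : ℕ → Bool := fun i => s.getD i false
  have hpad (ω : ℕ → Bool) : Tendsto (fun n => pad (initialWord n ω)) atTop (𝓝 ω) := by
    rw [tendsto_pi_nhds]
    intro i
    refine tendsto_const_nhds.congr' ?_
    filter_upwards [eventually_gt_atTop i] with n hn
    simp [pad, initialWord, hn]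
  obtain ⟨C, hC⟩ := isCompact_univ.exists_bound_of_continuousOn hc.continuousOn
  have hint (n : ℕ) : Integrable (fun ω => h (pad (initialWord n ω))) coinMeasure :=
    integrable_comp_initialWord (fun s => h (pad s)) n
  have hlim : Tendsto (fun n => ∫ ω, ‖h ω - h (pad (initialWord n ω))‖ ∂coinMeasure) atTop
      (𝓝 (∫ _, (0 : ℝ) ∂coinMeasure)) := by
    refine tendsto_integral_of_dominated_convergence (fun _ => C + C)
      (fun n => (hi.sub (hint n)).norm.aestronglyMeasurable) (integrable_const _)
      (fun n => .of_forall fun ω => ?_) (.of_forall fun ω => ?_)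
    · rw [norm_norm]
      exact (norm_sub_le _ _).trans (add_le_add (hC _ trivial) (hC _ trivial))
    · have := ((hc.tendsto ω).comp (hpad ω)).const_sub (h ω) |>.norm
      simpa using this
  rw [integral_zero] at hlim
  obtain ⟨n₀, hn₀⟩ := eventually_atTop.mp (hlim.eventually (gt_mem_nhds (half_pos hε)))
  refine ⟨n₀, fun n hn => ⟨fun s => h (pad s), ?_⟩⟩
  calc ∫ ω, ‖g ω - h (pad (initialWord n ω))‖ ∂coinMeasure
      ≤ ∫ ω, (‖g ω - h ω‖ + ‖h ω - h (pad (initialWord n ω))‖) ∂coinMeasure :=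
        integral_mono (hg.sub (hint n)).norm ((hg.sub hi).norm.add (hi.sub (hint n)).norm)
          fun ω => norm_sub_le_norm_sub_add_norm_sub _ _ _
    _ = ∫ ω, ‖g ω - h ω‖ ∂coinMeasure + ∫ ω, ‖h ω - h (pad (initialWord n ω))‖ ∂coinMeasure :=
        integral_add (hg.sub hi).norm (hi.sub (hint n)).norm
    _ ≤ ε := by linarith [hn₀ n hn]

/-- A dyadic martingale with an integrable density converges to it in `L¹`. -/
lemma exists_forall_integral_norm_sub_le [CompleteSpace E] {t : List Bool → E}
    {g : (ℕ → Bool) → E} (hg : Integrable g coinMeasure)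
    (hgt : ∀ s, ∫ ω in cell s, g ω ∂coinMeasure = (1 / 2 : ℝ) ^ s.length • t s) {ε : ℝ}
    (hε : 0 < ε) :
    ∃ n₀, ∀ n ≥ n₀, ∫ ω, ‖g ω - t (initialWord n ω)‖ ∂coinMeasure ≤ ε := by
  obtain ⟨n₀, h⟩ := exists_approx_by_initialWord hg (half_pos hε)
  refine ⟨n₀, fun n hn => ?_⟩
  obtain ⟨φ, hφ⟩ := h n hn
  have hφi := integrable_comp_initialWord φ n
  have hti := integrable_comp_initialWord t n
  -- On cells of level `n`, `t - φ` is the average of `g - φ`.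
  have key : ∫ ω, ‖t (initialWord n ω) - φ (initialWord n ω)‖ ∂coinMeasure ≤
      ∫ ω, ‖g ω - φ (initialWord n ω)‖ ∂coinMeasure := by
    refine integral_norm_le (a := fun s => t s - φ s) (hg.sub hφi) fun s hs => ?_
    subst hs
    simp only [Pi.sub_apply]
    rw [integral_sub hg.integrableOn hφi.integrableOn, hgt, setIntegral_cell_self, smul_sub]
  calc ∫ ω, ‖g ω - t (initialWord n ω)‖ ∂coinMeasure
      ≤ ∫ ω, (‖g ω - φ (initialWord n ω)‖ + ‖t (initialWord n ω) - φ (initialWord n ω)‖)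
          ∂coinMeasure :=
        integral_mono (hg.sub hti).norm ((hg.sub hφi).norm.add (hti.sub hφi).norm) fun ω => by
          rw [norm_sub_rev (t _)]
          exact norm_sub_le_norm_sub_add_norm_sub _ _ _
    _ = ∫ ω, ‖g ω - φ (initialWord n ω)‖ ∂coinMeasure +
          ∫ ω, ‖t (initialWord n ω) - φ (initialWord n ω)‖ ∂coinMeasure :=
        integral_add (hg.sub hφi).norm (hti.sub hφi).norm
    _ ≤ ε := by linarith

omit [NormedSpace ℝ E] in
lemma wordMean_le_of_integral_le {t : List Bool → E} {g : (ℕ → Bool) → E}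
    (hg : Integrable g coinMeasure) {n N : ℕ} (hnN : n ≤ N) {ε : ℝ}
    (hn : ∫ ω, ‖g ω - t (initialWord n ω)‖ ∂coinMeasure ≤ ε)
    (hN : ∫ ω, ‖g ω - t (initialWord N ω)‖ ∂coinMeasure ≤ ε) :
    wordMean N (fun s => ‖t s - t (s.take n)‖) ≤ ε + ε := by
  have hi (k : ℕ) := (hg.sub (integrable_comp_initialWord t k)).norm
  rw [← integral_eq_wordMean]
  refine le_trans (integral_mono (integrable_comp_initialWord (fun s => ‖t s - t (s.take n)‖) N)
    ((hi N).add (hi n)) fun ω => ?_)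
    ((integral_add (hi N) (hi n)).trans_le (add_le_add hN hn))
  simp only [take_initialWord hnN, Pi.add_apply, Pi.sub_apply]
  rw [norm_sub_rev (g ω)]
  exact norm_sub_le_norm_sub_add_norm_sub _ _ _

end Integrals

variable {X : Type*} [NormedAddCommGroup X] [NormedSpace ℝ X]

/-- `G A` is the weak* limit, along one fixed ultrafilter, of the integrals over `A` of the levels
of `t`. Limits preserve finite additivity; domination by `coinMeasure` makes it countable. On cells
the integrals are eventually constant. -/
lemma exists_vectorMeasure_of_isDyadicMartingale {t : List Bool → StrongDual ℝ X}
    (ht : IsDyadicMartingale t) :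
    ∃ G : VectorMeasure (ℕ → Bool) (StrongDual ℝ X), (∀ A, ‖G A‖ₑ ≤ coinMeasure A) ∧
      ∀ s, G (cell s) = (1 / 2 : ℝ) ^ s.length • t s := by
  classical
  let Φ (n : ℕ) (A : Set (ℕ → Bool)) : StrongDual ℝ X :=
    ∫ ω in A, t (initialWord n ω) ∂coinMeasure
  have hΦ (A : Set (ℕ → Bool)) (n : ℕ) : ‖Φ n A‖ ≤ coinMeasure.real A := by
    simpa using norm_setIntegral_le_of_norm_le_const (μ := coinMeasure) (s := A) (C := 1)
      (measure_lt_top _ _) (fun ω _ => ht.norm_le (initialWord n ω))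
  have hlim (A : Set (ℕ → Bool)) : ∃ f : WeakDual ℝ X,
      ‖WeakDual.toStrongDual f‖ ≤ coinMeasure.real A ∧
      Tendsto (fun n => StrongDual.toWeakDual (Φ n A)) (hyperfilter ℕ) (𝓝 f) := by
    obtain ⟨f, hf, hle⟩ := (WeakDual.isCompact_closedBall (𝕜 := ℝ) (0 : StrongDual ℝ X)
      (coinMeasure.real A)).ultrafilter_le_nhds'
        ((hyperfilter ℕ).map fun n => StrongDual.toWeakDual (Φ n A))
        (Ultrafilter.mem_map.mpr (Filter.univ_mem' fun n => by simpa using hΦ A n))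
    exact ⟨f, by simpa using hf, hle⟩
  choose L hL hLt using hlim
  let m (A : Set (ℕ → Bool)) : StrongDual ℝ X :=
    if MeasurableSet A then WeakDual.toStrongDual (L A) else 0
  have hm (A : Set (ℕ → Bool)) : ‖m A‖ₑ ≤ coinMeasure A := by
    by_cases hA : MeasurableSet A
    · simp only [m, if_pos hA]
      rw [← ofReal_norm, ← ofReal_measureReal]
      exact ENNReal.ofReal_le_ofReal (hL A)
    · have h0 : m A = 0 := if_neg hA
      rw [h0, ← ofReal_norm, norm_zero, ENNReal.ofReal_zero]
      exact zero_le
  refine ⟨VectorMeasure.of_additive_of_le_measure m hm ?_ fun A hA => by simp [m, hA], hm, ?_⟩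
  · intro A B hA hB hAB
    simp only [m, if_pos hA, if_pos hB, if_pos (hA.union hB)]
    rw [← map_add]
    congr 1
    refine tendsto_nhds_unique (hLt (A ∪ B)) (((hLt A).add (hLt B)).congr fun n => ?_)
    rw [← map_add]
    congr 1
    exact (setIntegral_union hAB hB (integrable_comp_initialWord t n).integrableOn
      (integrable_comp_initialWord t n).integrableOn).symm
  · intro s
    change m (cell s) = _
    simp only [m, if_pos (measurableSet_cell s)]
    rw [← StrongDual.toStrongDual_toWeakDual ((1 / 2 : ℝ) ^ s.length • t s)]
    congr 1
    refine tendsto_nhds_unique (hLt (cell s)) (tendsto_const_nhds.congr' ?_)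
    have : ∀ᶠ n in (hyperfilter ℕ : Filter ℕ), s.length ≤ n :=
      (Nat.hyperfilter_le_atTop) (eventually_ge_atTop s.length)
    filter_upwards [this] with n hn
    obtain ⟨k, rfl⟩ := Nat.exists_eq_add_of_le hn
    rw [← ht.setIntegral_cell k s]

/-- If `X*` has the Radon–Nikodým property, then every dyadic martingale in its unit ball is
Cauchy in mean. -/
theorem RadonNikodymProperty.exists_forall_wordMean_le
    (h : RadonNikodymProperty (StrongDual ℝ X)) {t : List Bool → StrongDual ℝ X}
    (ht : IsDyadicMartingale t) {ε : ℝ} (hε : 0 < ε) :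
    ∃ n, ∀ N ≥ n, wordMean N (fun s => ‖t s - t (s.take n)‖) ≤ ε := by
  obtain ⟨G, hG, hGt⟩ := exists_vectorMeasure_of_isDyadicMartingale ht
  obtain ⟨g, hg, hGg⟩ := h (ℕ → Bool) coinMeasure G
    ((VectorMeasure.variation_le_of_forall_enorm_le (fun A _ => hG A) Set.univ).trans_lt
      (measure_lt_top _ _))
    (fun A _ hA => by
      have := hG A
      rw [hA, ← ofReal_norm, nonpos_iff_eq_zero, ENNReal.ofReal_eq_zero] at this
      exact norm_le_zero_iff.mp this)
  obtain ⟨n, hn⟩ := exists_forall_integral_norm_sub_le (t := t) hg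
    (fun s => by rw [← hGg _ (measurableSet_cell s), hGt]) (half_pos hε)
  refine ⟨n, fun N hN => ?_⟩
  simpa using wordMean_le_of_integral_le hg hN (hn n le_rfl) (hn N hN)

end LocalDiameterTwo

/-! ### Geometry of weak* slices and the conclusion -/

namespace LocalDiameterTwo

lemma convex_of_isClosed_of_midpoint {E : Type*} [AddCommGroup E] [Module ℝ E]
    [TopologicalSpace E] [IsTopologicalAddGroup E] [ContinuousSMul ℝ E] {S : Set E}
    (hS : IsClosed S) (hmid : ∀ p ∈ S, ∀ q ∈ S, (1 / 2 : ℝ) • (p + q) ∈ S) : Convex ℝ S := by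
  rw [convex_iff_segment_subset]
  intro p hp q hq
  rw [segment_eq_image_lineMap]
  rintro _ ⟨z, hz, rfl⟩
  let D : Set ℝ := AffineMap.lineMap p q ⁻¹' S
  have hD : IsClosed D := hS.preimage AffineMap.lineMap_continuous
  have hDmid : ∀ a ∈ D, ∀ b ∈ D, (a + b) / 2 ∈ D := by
    intro a ha b hb
    have := hmid _ ha _ hb
    change AffineMap.lineMap p q ((a + b) / 2) ∈ S
    convert! this using 1
    simp only [AffineMap.lineMap_apply_module]
    module
  have hA : IsCompact (D ∩ Set.Icc 0 z) := isCompact_Icc.inter_left hD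
  have hB : IsCompact (D ∩ Set.Icc z 1) := isCompact_Icc.inter_left hD
  obtain ⟨haD, ha⟩ := hA.sSup_mem ⟨0, by simpa [D] using hp, le_rfl, hz.1⟩
  obtain ⟨hbD, hb⟩ := hB.sInf_mem ⟨1, by simpa [D] using hq, hz.2, le_rfl⟩
  -- `a` and `b` bound the gap of `D` around `z`. Their midpoint lies in `D`, which forces one of
  -- them to equal `z`.
  set a := sSup (D ∩ Set.Icc 0 z)
  set b := sInf (D ∩ Set.Icc z 1)
  have hm := hDmid a haD b hbD
  rcases le_total ((a + b) / 2) z with h | h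
  · have := le_csSup hA.bddAbove (⟨hm, by linarith [ha.1, hb.1, hz.1], h⟩ :
      (a + b) / 2 ∈ D ∩ Set.Icc 0 z)
    change (a + b) / 2 ≤ a at this
    have hz' : b = z := by linarith [ha.2, hb.1]
    exact hz' ▸ hbD
  · have := csInf_le hB.bddBelow (⟨hm, h, by linarith [ha.2, hb.2, hz.2]⟩ :
      (a + b) / 2 ∈ D ∩ Set.Icc z 1)
    change b ≤ (a + b) / 2 at this
    have hz' : a = z := by linarith [ha.2, hb.1]
    exact hz' ▸ haD

variable {X : Type*} [NormedAddCommGroup X] [NormedSpace ℝ X]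

/-- In a space with the LD2P+, every weak* slice of the dual ball has large diameter. -/
lemma LD2PPlus.exists_far_in_weakStarSlice (h : LD2PPlus X) {x : X} (hx : ‖x‖ = 1) {δ : ℝ}
    (hδ : 0 < δ) : ∃ a ∈ weakStarSlice x δ, ∃ b ∈ weakStarSlice x δ, 1 ≤ ‖a - b‖ := by
  obtain ⟨f, hf, hfx⟩ := exists_dual_vector ℝ x (by rw [hx]; exact one_ne_zero)
  have hfx : f x = 1 := by simpa [hx] using hfx
  -- If `g` norms `x - y`, then `g x > 1 - δ` and `g y < -1 / 2`, while `f y > 1 / 2`.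
  obtain ⟨y, ⟨hy, hfy⟩, hxy⟩ := h f hf (1 / 2) (by norm_num) (min δ (1 / 2)) (by positivity) x
    ⟨hx.le, by rw [hfx]; norm_num⟩ hx
  have h₁ := min_le_left δ (1 / 2)
  have h₂ := min_le_right δ (1 / 2)
  obtain ⟨g, hg, hgxy⟩ := exists_dual_vector ℝ (x - y) (by linarith)
  have hgxy : g x - g y = ‖x - y‖ := by simpa using hgxy
  have hgx : |g x| ≤ 1 := (g.le_of_opNorm_le hg.le x).trans (by rw [hx, one_mul])
  have hgy : |g y| ≤ 1 := (g.le_of_opNorm_le hg.le y).trans (by rwa [one_mul])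
  rw [abs_le] at hgx hgy
  refine ⟨f, ⟨hf.le, by linarith⟩, g, ⟨hg.le, by linarith⟩, ?_⟩
  have hfg : f y - g y ≤ ‖f - g‖ := by
    refine (le_abs_self _).trans (((f - g).le_opNorm y).trans ?_)
    exact mul_le_of_le_one_right (norm_nonneg _) hy
  linarith

lemma LD2PPlus.not_isWeakStarDentingPoint (h : LD2PPlus X) (f : StrongDual ℝ X) :
    ¬ IsWeakStarDentingPoint f := by
  rintro ⟨-, hf⟩
  obtain ⟨x, hx, δ, hδ, -, hdiam⟩ := hf 1 one_pos
  obtain ⟨a, ha, b, hb, hab⟩ := h.exists_far_in_weakStarSlice hx hδ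
  have hbdd : Bornology.IsBounded (weakStarSlice x δ) :=
    (Metric.isBounded_closedBall (x := (0 : StrongDual ℝ X)) (r := 1)).subset
      fun g hg => by simpa using hg.1
  have := Metric.dist_le_diam_of_mem hbdd ha hb
  rw [dist_eq_norm] at this
  linarith

/-- A midpoint convex subset of the dual that meets every weak* slice of the unit ball is weak*
dense in the unit ball. -/
lemma exists_near_of_forall_weakStarSlice [Nontrivial X] {M : Set (StrongDual ℝ X)}
    (hmid : ∀ p ∈ M, ∀ q ∈ M, (1 / 2 : ℝ) • (p + q) ∈ M)
    (hM : ∀ x : X, ‖x‖ = 1 → ∀ δ : ℝ, 0 < δ → ∃ p ∈ M, p ∈ weakStarSlice x δ)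
    {f : StrongDual ℝ X} (hf : ‖f‖ ≤ 1) (F : Finset X) {η : ℝ} (hη : 0 < η) :
    ∃ p ∈ M, ∀ x ∈ F, |p x - f x| ≤ η := by
  let T : StrongDual ℝ X → F → ℝ := fun p x => p x
  suffices hT : T f ∈ closure (T '' M) by
    obtain ⟨_, ⟨p, hp, rfl⟩, hd⟩ := Metric.mem_closure_iff.mp hT η hη
    refine ⟨p, hp, fun x hx => ?_⟩
    rw [← Real.dist_eq, dist_comm]
    exact (dist_le_pi_dist (T f) (T p) ⟨x, hx⟩).trans hd.le
  have hconv : Convex ℝ (closure (T '' M)) := by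
    refine convex_of_isClosed_of_midpoint isClosed_closure fun p hp q hq => ?_
    refine map_mem_closure₂ (f := fun p q => (1 / 2 : ℝ) • (p + q)) (by fun_prop) hp hq ?_
    rintro _ ⟨p, hp, rfl⟩ _ ⟨q, hq, rfl⟩
    exact ⟨_, hmid p hp q hq, rfl⟩
  by_contra hnot
  obtain ⟨L, u, hL, hu⟩ := geometric_hahn_banach_closed_point hconv isClosed_closure hnot
  classical
  -- The separating functional on `F → ℝ` is evaluation at this `x`.
  let x : X := ∑ i : F, L (Pi.single i 1) • (i : X)
  have hLx (p : StrongDual ℝ X) : L (T p) = p x := by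
    have := LinearMap.pi_apply_eq_sum_univ (L : (F → ℝ) →ₗ[ℝ] ℝ) (T p)
    simp only [ContinuousLinearMap.coe_coe, smul_eq_mul] at this
    rw [this, map_sum]
    refine Finset.sum_congr rfl fun i _ => ?_
    rw [map_smul, smul_eq_mul, mul_comm]
    congr 2
    ext j
    simp [Pi.single_apply, eq_comm]
  have hMu (p) (hp : p ∈ M) : p x < u := hLx p ▸ hL _ (subset_closure ⟨p, hp, rfl⟩)
  rw [hLx] at hu
  have hx0 : x ≠ 0 := by
    intro h0
    obtain ⟨x₁, hx₁⟩ := exists_norm_eq X zero_le_one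
    obtain ⟨p, hp, -⟩ := hM x₁ hx₁ 1 one_pos
    have := hMu p hp
    rw [h0, map_zero] at this hu
    linarith
  have hxp : 0 < ‖x‖ := norm_pos_iff.mpr hx0
  have hux : u < ‖x‖ := hu.trans_le
    ((le_abs_self _).trans ((f.le_of_opNorm_le hf x).trans_eq (one_mul _)))
  -- This width makes the slice the part of the ball where `p x > u`, which `M` should miss.
  obtain ⟨p, hp, -, hps⟩ := hM (‖x‖⁻¹ • x) (norm_smul_inv_norm (𝕜 := ℝ) hx0) (1 - u / ‖x‖)
    (by rw [sub_pos, div_lt_one hxp]; exact hux)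
  have := hMu p hp
  rw [map_smul, smul_eq_mul, sub_sub_cancel, inv_mul_eq_div, div_lt_div_iff_of_pos_right hxp] at hps
  linarith

theorem LD2PPlus.not_radonNikodymProperty [Nontrivial X] (h : LD2PPlus X) :
    ¬ RadonNikodymProperty (StrongDual ℝ X) := by
  intro hRN
  let M : Set (StrongDual ℝ X) :=
    {f | ∃ t : List Bool → StrongDual ℝ X, IsDyadicMartingale t ∧ Oscillates 0 t ∧ t [] = f}
  have hmid : ∀ p ∈ M, ∀ q ∈ M, (1 / 2 : ℝ) • (p + q) ∈ M := by
    rintro _ ⟨t₀, h₀, o₀, rfl⟩ _ ⟨t₁, h₁, o₁, rfl⟩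
    -- Joining gives oscillation relative to the first letter, which is stronger than level `0`.
    exact ⟨join t₀ t₁, h₀.join h₁, (o₀.join o₁).of_succ, rfl⟩
  have hM : ∀ x : X, ‖x‖ = 1 → ∀ δ : ℝ, 0 < δ → ∃ p ∈ M, p ∈ weakStarSlice x δ := by
    intro x hx δ hδ
    obtain ⟨a, ⟨ha, hax⟩, b, ⟨hb, hbx⟩, hab⟩ := h.exists_far_in_weakStarSlice hx hδ
    have hj := (isDyadicMartingale_const ha).join (isDyadicMartingale_const hb)
    refine ⟨_, ⟨_, hj, oscillates_join_const hab, rfl⟩, hj.norm_le [], ?_⟩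
    simp only [join, smul_apply, add_apply, smul_eq_mul]
    linarith
  obtain ⟨t, ht, hgt⟩ := exists_martingale_forall_wordMean_gt (X := X) fun f hf F η hη => by
    obtain ⟨_, ⟨t, ht, ho, rfl⟩, hx⟩ := exists_near_of_forall_weakStarSlice hmid hM hf F hη
    exact ⟨t, ht, ho, hx⟩
  obtain ⟨n, hn⟩ := hRN.exists_forall_wordMean_le ht (ε := 1 / 4) (by norm_num)
  obtain ⟨N, hN, hlt⟩ := hgt n
  exact absurd (hn N hN) (not_le.mpr hlt)

end LocalDiameterTwo

theorem corollary3p6 (X : Type*) [NormedAddCommGroup X] [NormedSpace ℝ X] [CompleteSpace X]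
    [Nontrivial X] :
    ((∃ f : StrongDual ℝ X, LocalDiameterTwo.IsWeakStarDentingPoint f) →
      ¬ LocalDiameterTwo.LD2PPlus X) ∧
    (LocalDiameterTwo.RadonNikodymProperty (StrongDual ℝ X) →
      ¬ LocalDiameterTwo.LD2PPlus X) := by
  exact ⟨fun ⟨f, hf⟩ h => h.not_isWeakStarDentingPoint f hf,
    fun hRN h => h.not_radonNikodymProperty hRN⟩
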